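/- \textbf{Setting.} Let $(\mathcal V,\mathcal E)$ be a finite directed graph with a destination $d\in\mathcal V$, maximal lifetime $L\ge 1$, link capacities $C_{ij}\ge 0$ and unit costs $e_{ij}\ge 0$. In slot $t=0,1,2,\dots$, $a_i^{(l)}(t)\in[0,A_{\max}]$ packets of lifetime $l\in\{1,\dots,L\}$ arrive at node $i$, with $a_d^{(l)}(t)=0$. The arrival vectors are i.i.d. over time with mean $\lambda=(\lambda_i^{(l)})$. A flow is $x=(x_{ij}^{(l)})_{(i,j)\in\mathcal E,\,1\le l\le L}$. Write $x_{ij}=\sum_l x_{ij}^{(l)}$, and $x_{\to i}^{(l)}$, $x_{i\to}^{(l)}$ for the total lifetime-$l$ flow into and out of $i$. Superscripts $(\ge l)$, $(\le l)$ denote sums over the lifetimes $\ge l$, $\le l$ in $\{1,\dots,L\}$. Put $x_{\to d}=\sum_l x_{\to d}^{(l)}$, $A(t)=\sum_{i,l}a_i^{(l)}(t)$ and $h(x)=\sum_{(i,j)\in\mathcal E} e_{ij}x_{ij}$. A \emph{feasible decision} is a flow $x\ge 0$ with $x_{ij}\le C_{ij}$ for all links and $x_{dk}^{(l)}=0$ for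 all links $(d,k)$ and all $l$. \textbf{Problem $\mathscr P_2$.} For a sequence $z(t)$ let $\overline{z(t)}=\lim_{T\to\infty}\frac1T\sum_{t<T}z(t)$. A policy admissible for $(\lambda,\gamma)$ is a sequence of random feasible decisions $x(t)$ such that the following averages exist and satisfy $$\overline{\mathbb E\,x_{\to d}(t)}\ge\gamma\|\lambda\|_1,\qquad \overline{\mathbb E\,x_{i\to}^{(\ge l)}(t)}\le\overline{\mathbb E\,x_{\to i}^{(\ge l+1)}(t)}+\lambda_i^{(\ge l)}\quad(i\ne d,\ 1\le l\le L).$$ The capacity region is the set of pairs $(\lambda,\gamma)$ for which an admissible policy exists, and $h_2^\star(\lambda,\gamma)$ is the infimum of $\overline{\mathbb E\,h(x(t))}$ over the admissible policies for which this limit exists. \textbf{Algorithm with parameter $V\ge0$.} The virtual queues start from a deterministic nonnegative state, the same for all $V$, and $$U_d(t+1)=\max\{0,U_d(t)+\gamma A(t)-\nu_{\to d}(t)\},$$ $$U_i^{(l)}(t+1)=\max\{0,U_i^{(l)}(t)+\nu_{i\to}^{(\ge l)}(t)-\nu_{\to i}^{(\ge l+1)}(t)-a_i^{(\ge l)}(t)\}\quad(i\ne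 d).$$ For a link $(i,j)$ with $i\neq d$ let $w_{ij}^{(l)}(t)=-Ve_{ij}-U_i^{(\le l)}(t)+U_d(t)$ if $j=d$, and $w_{ij}^{(l)}(t)=-Ve_{ij}-U_i^{(\le l)}(t)+U_j^{(\le l-1)}(t)$ if $j\ne d$. Put $\nu_{ij}^{(l)}(t)=C_{ij}$ if $l=l^\star$ and $w_{ij}^{(l^\star)}(t)>0$, and $\nu_{ij}^{(l)}(t)=0$ otherwise, where $l^\star$ maximizes $w_{ij}^{(l)}(t)$ over $l$, with ties broken by any fixed measurable rule. Links leaving $d$ carry nothing. \textbf{Drift constant.} Let $\mathcal L(U)=\frac12\bigl(U_d^2+\sum_{i\ne d}\sum_l (U_i^{(l)})^2\bigr)$. A number $B$ is a \emph{drift constant} if, for all $V\in\mathbb R$, all nonnegative queue states $U$, all possible arrivals $a$ in one slot ($0\le a_i^{(l)}\le A_{\max}$, $a_d^{(l)}=0$) and all feasible decisions $\nu$, with $U'$ the next queue state, $A$ the total of $a$ and $w$ the weights for $U$ and $V$, $$\mathcal L(U')-\mathcal L(U)+Vh(\nu)\le B+\gamma A\,U_d-\sum_{i\neq d}\sum_l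 a_i^{(\ge l)}U_i^{(l)}-\sum_{(i,j)\in\mathcal E,\ i\ne d}\ \sum_l w_{ij}^{(l)}\nu_{ij}^{(l)}.$$ \textbf{Claim.} Let $(\lambda,\gamma)$ be a point of the capacity region (in particular, any interior point). (1) For every $V\ge 0$ all virtual queues are mean rate stable: $\mathbb E[U_d(t)]/t\to0$, and $\mathbb E[U_i^{(l)}(t)]/t\to 0$ for all $i\ne d$ and all $l$ (the expectations, and those of $\nu_{ij}^{(l)}(t)$, being finite). (2) For every $\varepsilon>0$ the convergence time $$t_\varepsilon=\min\Bigl\{\tau\ge1:\ \sup_{s\ge\tau}\Bigl[\gamma\|\lambda\|_1-\frac1s\sum_{t=0}^{s-1}\mathbb E\,\nu_{\to d}(t)\Bigr]\le\varepsilon\Bigr\}$$ is finite for all $V\ge 1$ and is $\mathcal O(V)$: there is $K$, not depending on $V$, with $t_\varepsilon\le KV$ for all $V\ge1$. (3) Drift constants exist (they depend only on the network, $\gamma$ and $A_{\max}$), and for every drift constant $B$ and every $V>0$ $$\limsup_{T\to\infty}\frac1T\sum_{t=0}^{T-1}\mathbb E\,h(\nu(t))\le h_2^\star(\lambda,\gamma)+\frac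 BV .$$ -/

import Mathlib

open MeasureTheory ProbabilityTheory Filter Topology

namespace DelayNet

/-- A packet routing network: directed links between nodes, the destination, the maximal lifetime,
and the capacity and unit transmission cost of every link. -/
structure Network (V : Type*) where
  links : Finset (V × V)
  dest : V
  maxLife : ℕ
  maxLife_pos : 0 < maxLife
  cap : {p : V × V // p ∈ links} → ℝ
  cap_nonneg : ∀ e, 0 ≤ cap e
  unitCost : {p : V × V // p ∈ links} → ℝ
  unitCost_nonneg : ∀ e, 0 ≤ unitCost e

/-- The expression `HasTimeAvg z c` says that `(1 / T) * ∑_{t < T} z t` converges to `c`. -/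
def HasTimeAvg (z : ℕ → ℝ) (c : ℝ) : Prop :=
  Tendsto (fun T : ℕ => (∑ t ∈ Finset.range T, z t) / (T : ℝ)) atTop (𝓝 c)

/-- Mean rate stability of a nonnegative queue process. -/
def MeanRateStable {Ω : Type*} [MeasurableSpace Ω] (μ : Measure Ω) (Q : ℕ → Ω → ℝ) : Prop :=
  (∀ t, Integrable (Q t) μ) ∧ Tendsto (fun t : ℕ => (∫ ω, Q t ω ∂μ) / (t : ℝ)) atTop (𝓝 0)

namespace Network

section Basic

variable {V : Type*} (N : Network V)

/-- The links of the network. -/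
abbrev Link : Type _ := {p : V × V // p ∈ N.links}

/-- The lifetimes `1, …, maxLife`. The element with index `k` stands for lifetime `k + 1`; only the
order matters below, so `(≥ l)` is `Finset.Ici l`, `(≥ l + 1)` is `Finset.Ioi l`,
`(≤ l)` is `Finset.Iic l` and `(≤ l - 1)` is `Finset.Iio l`. -/
abbrev Life : Type := Fin N.maxLife

/-- Flow variables: the amount of packets of each lifetime sent over each link. -/
abbrev Flow : Type _ := N.Link → N.Life → ℝ

/-- Quantities indexed by node and lifetime (arrivals, arrival rates). -/
abbrev Arrival : Type _ := V → N.Life → ℝ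

/-- Total flow over a link. -/
def linkFlow (x : N.Flow) (e : N.Link) : ℝ := ∑ l, x e l

/-- Transmission cost of a flow. -/
def cost (x : N.Flow) : ℝ := ∑ e, N.unitCost e * N.linkFlow x e

end Basic

section Model

variable {V : Type*} [Fintype V] [DecidableEq V] (N : Network V)

/-- Flow of lifetime `l` into node `i`. -/
def flowIn (x : N.Flow) (i : V) (l : N.Life) : ℝ :=
  ∑ e : N.Link with e.1.2 = i, x e l

/-- Flow of lifetime `l` out of node `i`. -/
def flowOut (x : N.Flow) (i : V) (l : N.Life) : ℝ :=
  ∑ e : N.Link with e.1.1 = i, x e l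

/-- Total flow (of all lifetimes) delivered to the destination. -/
def delivered (x : N.Flow) : ℝ := ∑ l, N.flowIn x N.dest l

/-- Total over all nodes and lifetimes. For an arrival rate vector this is its 1-norm, as rates
are nonnegative. -/
def total (a : N.Arrival) : ℝ := ∑ i, ∑ l, a i l

/-- The decisions that are allowed in one time slot of the virtual network: nonnegative, within
the link capacities, and with no transmission by the destination. -/
structure FeasibleDecision (x : N.Flow) : Prop where
  nonneg : ∀ e l, 0 ≤ x e l
  le_cap : ∀ e, N.linkFlow x e ≤ N.cap e
  from_dest : ∀ e l, e.1.1 = N.dest → x e l = 0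

/-- Admissibility of a (possibly random) sequence of decisions for the virtual network problem with
arrival rates `lam` and reliability level `γ`: the decisions are feasible in each slot, and the
long-term averages that occur in the reliability and the causality constraint exist and satisfy
the constraint. -/
structure Admissible (lam : N.Arrival) (γ : ℝ) {Ω : Type*} [MeasurableSpace Ω] (P : Measure Ω)
    (x : ℕ → Ω → N.Flow) : Prop where
  measurable : ∀ t e l, Measurable fun ω => x t ω e l
  feasible : ∀ t ω, N.FeasibleDecision (x t ω)
  reliability : ∃ r, HasTimeAvg (fun t => ∫ ω, N.delivered (x t ω) ∂P) r ∧ γ * N.total lam ≤ r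
  causality : ∀ i, i ≠ N.dest → ∀ l : N.Life, ∃ o r,
    HasTimeAvg (fun t => ∫ ω, ∑ m ∈ Finset.Ici l, N.flowOut (x t ω) i m ∂P) o ∧
    HasTimeAvg (fun t => ∫ ω, ∑ m ∈ Finset.Ioi l, N.flowIn (x t ω) i m ∂P) r ∧
    o ≤ r + ∑ m ∈ Finset.Ici l, lam i m

/-- The capacity region: the pairs (arrival rates, reliability level) for which there is an
admissible policy. -/
def capacityRegion : Set (N.Arrival × ℝ) :=
  {q | ∃ (Ω : Type) (_ : MeasurableSpace Ω) (P : Measure Ω) (x : ℕ → Ω → N.Flow),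
    IsProbabilityMeasure P ∧ N.Admissible q.1 q.2 P x}

/-- The average costs that admissible policies achieve. -/
def achievableCosts (lam : N.Arrival) (γ : ℝ) : Set ℝ :=
  {c | ∃ (Ω : Type) (_ : MeasurableSpace Ω) (P : Measure Ω) (x : ℕ → Ω → N.Flow),
    IsProbabilityMeasure P ∧ N.Admissible lam γ P x ∧
      HasTimeAvg (fun t => ∫ ω, N.cost (x t ω) ∂P) c}

/-- The optimal value of the virtual network problem. -/
noncomputable def optCost (lam : N.Arrival) (γ : ℝ) : ℝ := sInf (N.achievableCosts lam γ)

/-- The possible arrivals in one slot: between `0` and `Amax`, and none at the destination. -/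
structure PossibleArrival (Amax : ℝ) (a : N.Arrival) : Prop where
  nonneg : ∀ i l, 0 ≤ a i l
  le_max : ∀ i l, a i l ≤ Amax
  at_dest : ∀ l, a N.dest l = 0

/-- Bounded arrivals that are independent and identically distributed over time. Arrivals of
different nodes and lifetimes in the same slot may depend on each other. -/
structure IsIIDArrival (Amax : ℝ) {Ω : Type*} [MeasurableSpace Ω] (μ : Measure Ω)
    (a : ℕ → Ω → N.Arrival) : Prop where
  measurable : ∀ t, Measurable (a t)
  possible : ∀ t ω, N.PossibleArrival Amax (a t ω)
  indep : iIndepFun a μ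
  identDistrib : ∀ t, IdentDistrib (a t) (a 0) μ μ

/-- The mean arrival rates. -/
noncomputable def meanRate {Ω : Type*} [MeasurableSpace Ω] (μ : Measure Ω)
    (a : ℕ → Ω → N.Arrival) : N.Arrival :=
  fun i l => ∫ ω, a 0 ω i l ∂μ

/-- A state of the virtual queues: one queue at the destination, and one for every other node and
every lifetime (the entries `node N.dest l` are not used). -/
structure VirtualQueues where
  sink : ℝ
  node : V → N.Life → ℝ

/-- All virtual queues are nonnegative. -/
structure VirtualQueues.Nonneg {N : Network V} (U : N.VirtualQueues) : Prop where
  sink : 0 ≤ U.sink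
  node : ∀ i l, 0 ≤ U.node i l

/-- One step of the virtual queues, with arrivals `a` and decision `ν`. -/
noncomputable def queueStep (γ : ℝ) (U : N.VirtualQueues) (a : N.Arrival) (ν : N.Flow) :
    N.VirtualQueues where
  sink := max 0 (U.sink + γ * N.total a - N.delivered ν)
  node := fun i l =>
    if i = N.dest then 0
    else max 0 (U.node i l + ∑ m ∈ Finset.Ici l, N.flowOut ν i m
      - ∑ m ∈ Finset.Ioi l, N.flowIn ν i m - ∑ m ∈ Finset.Ici l, a i m)

/-- The weight of a lifetime on a link. -/
noncomputable def weight (W : ℝ) (U : N.VirtualQueues) (e : N.Link) (l : N.Life) : ℝ :=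
  - W * N.unitCost e - ∑ m ∈ Finset.Iic l, U.node e.1.1 m
    + if e.1.2 = N.dest then U.sink else ∑ m ∈ Finset.Iio l, U.node e.1.2 m

/-- A choice, for every link, of a lifetime of maximal weight (that is, a rule to break ties). -/
structure IsArgmaxRule (pick : N.Link → (N.Life → ℝ) → N.Life) : Prop where
  measurable : ∀ e, Measurable (pick e)
  le_pick : ∀ (e : N.Link) (w : N.Life → ℝ) (l : N.Life), w l ≤ w (pick e w)

/-- The max-weight decision: every link (not leaving the destination) spends its whole capacity on
the chosen lifetime of largest weight, if that weight is positive. -/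
noncomputable def decision (pick : N.Link → (N.Life → ℝ) → N.Life) (W : ℝ)
    (U : N.VirtualQueues) : N.Flow :=
  fun e l =>
    if e.1.1 ≠ N.dest ∧ l = pick e (N.weight W U e) ∧
        0 < N.weight W U e (pick e (N.weight W U e))
    then N.cap e else 0

/-- The virtual queues under the algorithm with parameter `W`, initial state `U₀` and
arrivals `α`. -/
noncomputable def queues (pick : N.Link → (N.Life → ℝ) → N.Life) (γ W : ℝ)
    (U₀ : N.VirtualQueues) (α : ℕ → N.Arrival) : ℕ → N.VirtualQueues
  | 0 => U₀
  | t + 1 =>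
    N.queueStep γ (queues pick γ W U₀ α t) (α t) (N.decision pick W (queues pick γ W U₀ α t))

/-- The decision of the algorithm in slot `t`. -/
noncomputable def algFlow (pick : N.Link → (N.Life → ℝ) → N.Life) (γ W : ℝ)
    (U₀ : N.VirtualQueues) (α : ℕ → N.Arrival) (t : ℕ) : N.Flow :=
  N.decision pick W (N.queues pick γ W U₀ α t)

/-- The quadratic Lyapunov function. -/
noncomputable def lyapunov (U : N.VirtualQueues) : ℝ :=
  (U.sink ^ 2 + ∑ i with i ≠ N.dest, ∑ l, U.node i l ^ 2) / 2

/-- `B` is a constant in the drift-plus-penalty bound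
`Δ(U) + W h(ν) ≤ B - ⟨ã, U⟩ - ⟨w, ν⟩`, for all parameters `W`, queue states `U`, possible arrivals
`a` and feasible decisions `ν`. Here `ã` has the entry `-γ A` at the destination, `A` the total
arrivals, and the entries `∑_{m ≥ l} a i m` at the other nodes. -/
def IsDriftConstant (γ Amax B : ℝ) : Prop :=
  ∀ (W : ℝ) (U : N.VirtualQueues) (a : N.Arrival) (ν : N.Flow),
    U.Nonneg → N.PossibleArrival Amax a → N.FeasibleDecision ν →
    N.lyapunov (N.queueStep γ U a ν) - N.lyapunov U + W * N.cost ν ≤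
      B - (- (γ * N.total a) * U.sink
            + ∑ i with i ≠ N.dest, ∑ l, (∑ m ∈ Finset.Ici l, a i m) * U.node i l)
        - ∑ e, ∑ l, N.weight W U e l * ν e l

/-- The `ε`-convergence time of a random sequence of decisions: the least `τ ≥ 1` such that for
every `s ≥ τ` the average expected delivery over the first `s` slots is at least the required rate
minus `ε`; it is `⊤` if there is no such `τ`. -/
noncomputable def convergenceTime (lam : N.Arrival) (γ : ℝ) {Ω : Type*} [MeasurableSpace Ω]
    (μ : Measure Ω) (ν : ℕ → Ω → N.Flow) (ε : ℝ) : ℕ∞ :=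
  ⨅ τ ∈ {τ : ℕ | 1 ≤ τ ∧ ∀ s : ℕ, τ ≤ s →
      γ * N.total lam - ∑ t ∈ Finset.range s, (∫ ω, N.delivered (ν t ω) ∂μ) / (s : ℝ) ≤ ε},
    (τ : ℕ∞)

end Model

end Network

end DelayNet

namespace DelayNet

namespace Network

/-! ### Linear algebra of the weights and the one-slot drift bound -/

section Linear

variable {V : Type*} [Fintype V] [DecidableEq V] (N : Network V)

/-! This is a drift-plus-penalty argument in which the comparison policy is a single deterministic
decision. The feasible decisions form a compact set that is stable under expectation and time
averaging. A limit point `y` of the averaged expected decisions of an admissible policy is therefore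
feasible, satisfies both constraints, and has the policy's average cost whenever that exists
(`Admissible.exists_stationary`).

For every queue state, the max-weight decision minimizes the drift-plus-penalty bound, so it does at
least as well as `y` (`IsDriftConstant.decision_le`). Arrivals in a slot are independent of the
queues there, so the constraints on `y` make every queue term nonpositive in mean. No slack is
needed, which is why boundary points of the capacity region are covered. Telescoping gives
(`IsIIDArrival.integral_lyapunov_le`) `E L(T) + W * ∑ E cost ≤ L(0) + T * (B + W * cost y)`.

Dropping the costs leaves `E L(T)` at most linear in `T`, with slope affine in `W`. Mean queues are
then `O(√T)`, which is mean rate stability. The delivery shortfall is at most the mean destination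
queue, which falls below `ε * T` once `T` exceeds a multiple of `W / ε ^ 2`. Dropping `E L(T)`
instead, dividing by `W * T` and optimizing over the policies gives the cost bound. -/

lemma sum_node_mul_sum_link (s : N.Link → V) (u : V → N.Life → ℝ) (x : N.Flow)
    (S S' : N.Life → Finset N.Life) (hS : ∀ l m, m ∈ S l ↔ l ∈ S' m) :
    ∑ i with i ≠ N.dest, ∑ l, u i l * ∑ m ∈ S l, ∑ e : N.Link with s e = i, x e m =
      ∑ e, ∑ m, (if s e = N.dest then 0 else ∑ l ∈ S' m, u (s e) l) * x e m := by
  -- Links are grouped by the endpoint `s e`, so both sides agree node by node. Exchanging the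
  -- lifetime sums turns `S` into its transpose `S'`: `Ici` into `Iic` for outflow, `Ioi` into `Iio`
  -- for inflow.
  rw [← Finset.sum_fiberwise (s := Finset.univ) (g := s), Finset.sum_filter]
  refine Finset.sum_congr rfl fun i _ => ?_
  split_ifs with hi
  · simp_rw [Finset.mul_sum]
    rw [Finset.sum_comm' (t' := Finset.univ) (s' := S') (by simp [hS])]
    simp_rw [Finset.sum_comm (s := S' _)]
    rw [Finset.sum_comm]
    refine Finset.sum_congr rfl fun e he => Finset.sum_congr rfl fun m _ => ?_
    obtain rfl : s e = i := by simpa using he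
    rw [if_neg hi, Finset.sum_mul]
  · refine (Finset.sum_eq_zero fun e he => ?_).symm
    obtain rfl : s e = i := by simpa using he
    simp [not_not.mp hi]

/-- The weights collect the cost of a flow and its effect on all virtual queues. -/
lemma sum_weight_mul (W : ℝ) (U : N.VirtualQueues) (x : N.Flow)
    (hx : ∀ e l, e.1.1 = N.dest → x e l = 0) :
    ∑ e, ∑ l, N.weight W U e l * x e l =
      -W * N.cost x + U.sink * N.delivered x - ∑ i with i ≠ N.dest, ∑ l,
        U.node i l * (∑ m ∈ Finset.Ici l, N.flowOut x i m - ∑ m ∈ Finset.Ioi l, N.flowIn x i m) := by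
  have hout := N.sum_node_mul_sum_link (fun e => e.1.1) U.node x Finset.Ici Finset.Iic (by simp)
  have hin := N.sum_node_mul_sum_link (fun e => e.1.2) U.node x Finset.Ioi Finset.Iio (by simp)
  have hdel : U.sink * N.delivered x =
      ∑ e : N.Link, ∑ l, (if e.1.2 = N.dest then U.sink else 0) * x e l := by
    simp only [delivered, flowIn]
    rw [Finset.sum_comm, Finset.mul_sum, Finset.sum_filter]
    refine Finset.sum_congr rfl fun e _ => ?_
    split_ifs <;> simp [Finset.mul_sum]
  have hcost : W * N.cost x = ∑ e : N.Link, ∑ l, W * N.unitCost e * x e l := by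
    simp only [cost, linkFlow, Finset.mul_sum, mul_assoc]
  simp only [mul_sub, Finset.sum_sub_distrib, flowOut, flowIn, neg_mul] at *
  rw [hout, hin, hdel, hcost]
  simp only [← Finset.sum_neg_distrib, ← Finset.sum_add_distrib, ← Finset.sum_sub_distrib]
  refine Finset.sum_congr rfl fun e _ => Finset.sum_congr rfl fun l _ => ?_
  -- On a link leaving the destination the weight involves queue entries that the right side omits;
  -- `hx` removes these links.
  by_cases h : e.1.1 = N.dest
  · simp [hx e l h]
  · simp only [weight, h, if_false]
    split_ifs <;> ring

omit [Fintype V] in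
lemma decision_feasible (pick : N.Link → (N.Life → ℝ) → N.Life) (W : ℝ) (U : N.VirtualQueues) :
    N.FeasibleDecision (N.decision pick W U) where
  nonneg e l := by
    unfold decision
    split_ifs
    exacts [N.cap_nonneg e, le_rfl]
  le_cap e := by
    unfold linkFlow decision
    by_cases h : e.1.1 ≠ N.dest ∧ 0 < N.weight W U e (pick e (N.weight W U e))
    · simp [h.1, h.2]
    · rw [Finset.sum_eq_zero]
      · exact N.cap_nonneg e
      · intro l _
        rw [if_neg (by tauto)]
  from_dest e l h := by simp [decision, h]

omit [Fintype V] in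
/-- The max-weight decision maximizes the weighted sum over the feasible decisions. -/
lemma sum_weight_mul_le_decision {pick : N.Link → (N.Life → ℝ) → N.Life}
    (hpick : N.IsArgmaxRule pick) (W : ℝ) (U : N.VirtualQueues) {x : N.Flow}
    (hx : N.FeasibleDecision x) :
    ∑ e, ∑ l, N.weight W U e l * x e l ≤
      ∑ e, ∑ l, N.weight W U e l * N.decision pick W U e l := by
  refine Finset.sum_le_sum fun e _ => ?_
  by_cases hd : e.1.1 = N.dest
  · simp [hx.from_dest e _ hd, decision, hd]
  set w := N.weight W U e
  have hle : ∑ l, w l * x e l ≤ w (pick e w) * N.linkFlow x e := by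
    rw [linkFlow, Finset.mul_sum]
    exact Finset.sum_le_sum fun l _ =>
      mul_le_mul_of_nonneg_right (hpick.le_pick e w l) (hx.nonneg e l)
  have hlf : 0 ≤ N.linkFlow x e := Finset.sum_nonneg fun l _ => hx.nonneg e l
  by_cases hw : 0 < w (pick e w)
  · have : ∑ l, w l * N.decision pick W U e l = w (pick e w) * N.cap e := by
      simp [decision, hd, w, hw]
    rw [this]
    exact hle.trans (mul_le_mul_of_nonneg_left (hx.le_cap e) hw.le)
  · have : ∑ l, w l * N.decision pick W U e l = 0 :=
      Finset.sum_eq_zero fun l _ => by simp [decision, w, hw]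
    rw [this]
    exact hle.trans (mul_nonpos_of_nonpos_of_nonneg (not_lt.mp hw) hlf)

omit [Fintype V] [DecidableEq V] in
variable {N} in
lemma FeasibleDecision.apply_le_cap {x : N.Flow} (hx : N.FeasibleDecision x) (e : N.Link)
    (l : N.Life) : x e l ≤ N.cap e :=
  (Finset.single_le_sum (fun m _ => hx.nonneg e m) (Finset.mem_univ l)).trans (hx.le_cap e)

omit [Fintype V] [DecidableEq V] in
variable {N} in
lemma FeasibleDecision.cost_nonneg {x : N.Flow} (hx : N.FeasibleDecision x) : 0 ≤ N.cost x :=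
  Finset.sum_nonneg fun e _ =>
    mul_nonneg (N.unitCost_nonneg e) (Finset.sum_nonneg fun l _ => hx.nonneg e l)

/-- A bound for the net inflow of every virtual queue in one slot. -/
lemma exists_increment_bound (γ Amax : ℝ) : ∃ M : ℝ, 0 ≤ M ∧ ∀ (a : N.Arrival) (x : N.Flow),
    N.PossibleArrival Amax a → N.FeasibleDecision x →
    |γ * N.total a - N.delivered x| ≤ M ∧
    ∀ i l, |∑ m ∈ Finset.Ici l, N.flowOut x i m - ∑ m ∈ Finset.Ioi l, N.flowIn x i m
      - ∑ m ∈ Finset.Ici l, a i m| ≤ M := by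
  -- Deliberately crude: `F` charges each link its full capacity once per lifetime, so it bounds a
  -- flow summed over any links and lifetimes. The absolute value in `A` avoids a sign condition on
  -- `Amax`.
  set F : ℝ := ∑ _l : N.Life, ∑ e, N.cap e
  set A : ℝ := ∑ _i : V, ∑ _l : N.Life, |Amax|
  have hF : 0 ≤ F := Finset.sum_nonneg fun _ _ => Finset.sum_nonneg fun e _ => N.cap_nonneg e
  have hA : 0 ≤ A := Finset.sum_nonneg fun _ _ => Finset.sum_nonneg fun _ _ => abs_nonneg _
  refine ⟨|γ| * A + 2 * F + A, by positivity, fun a x ha hx => ?_⟩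
  have hflow : ∀ (p : N.Link → Prop) [DecidablePred p] (S : Finset N.Life),
      0 ≤ ∑ m ∈ S, ∑ e with p e, x e m ∧ ∑ m ∈ S, ∑ e with p e, x e m ≤ F := by
    intro p _ S
    have h0 : ∀ m, 0 ≤ ∑ e with p e, x e m := fun m => Finset.sum_nonneg fun e _ => hx.nonneg e m
    refine ⟨Finset.sum_nonneg fun m _ => h0 m, ?_⟩
    refine (Finset.sum_le_univ_sum_of_nonneg h0).trans (Finset.sum_le_sum fun m _ => ?_)
    exact (Finset.sum_le_univ_sum_of_nonneg fun e => hx.nonneg e m).trans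
      (Finset.sum_le_sum fun e _ => hx.apply_le_cap e m)
  have harr : ∀ i (S : Finset N.Life), 0 ≤ ∑ m ∈ S, a i m ∧ ∑ m ∈ S, a i m ≤ A := by
    intro i S
    refine ⟨Finset.sum_nonneg fun m _ => ha.nonneg i m, ?_⟩
    refine (Finset.sum_le_univ_sum_of_nonneg (ha.nonneg i)).trans ?_
    refine (Finset.sum_le_sum fun m _ => (ha.le_max i m).trans (le_abs_self _)).trans ?_
    exact Finset.single_le_sum (f := fun _ : V => ∑ _l : N.Life, |Amax|)
      (fun _ _ => Finset.sum_nonneg fun _ _ => abs_nonneg _) (Finset.mem_univ i)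
  have htot : 0 ≤ N.total a ∧ N.total a ≤ A :=
    ⟨Finset.sum_nonneg fun i _ => Finset.sum_nonneg fun m _ => ha.nonneg i m,
      Finset.sum_le_sum fun i _ => Finset.sum_le_sum fun m _ =>
        (ha.le_max i m).trans (le_abs_self _)⟩
  have hγ : |γ * N.total a| ≤ |γ| * A := by
    rw [abs_mul, abs_of_nonneg htot.1]
    exact mul_le_mul_of_nonneg_left htot.2 (abs_nonneg γ)
  have hγA : 0 ≤ |γ| * A := by positivity
  constructor
  · have hd := hflow (fun e => e.1.2 = N.dest) Finset.univ
    simp only [delivered, flowIn]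
    rw [abs_le] at hγ ⊢
    constructor <;> linarith
  · intro i l
    have ho := hflow (fun e => e.1.1 = i) (Finset.Ici l)
    have hi := hflow (fun e => e.1.2 = i) (Finset.Ioi l)
    have har := harr i (Finset.Ici l)
    simp only [flowOut, flowIn]
    rw [abs_le]
    constructor <;> linarith

/-- Truncation at zero can only decrease the square. The cross term is kept exact because these
terms add up to the weights. -/
lemma max_zero_add_sq_le {u d M : ℝ} (hd : |d| ≤ M) :
    max 0 (u + d) ^ 2 ≤ u ^ 2 + 2 * (u * d) + M ^ 2 := by
  have h1 : max 0 (u + d) ^ 2 ≤ (u + d) ^ 2 := by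
    rcases le_total 0 (u + d) with h | h
    · rw [max_eq_right h]
    · rw [max_eq_left h, zero_pow two_ne_zero]; exact sq_nonneg _
  have h2 : d ^ 2 ≤ M ^ 2 := by
    rw [← sq_abs]; exact pow_le_pow_left₀ (abs_nonneg d) hd 2
  nlinarith

/-- By `sum_weight_mul`, the cross terms of the squared queues and the cost match the linear terms
of the bound exactly. Only the squared increments remain, at most `M ^ 2 / 2` per queue and
independent of `W`. -/
lemma exists_isDriftConstant (γ Amax : ℝ) : ∃ B : ℝ, N.IsDriftConstant γ Amax B := by
  obtain ⟨M, -, hM⟩ := N.exists_increment_bound γ Amax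
  refine ⟨(M ^ 2 + ∑ i with i ≠ N.dest, ∑ _l : N.Life, M ^ 2) / 2, fun W U a ν _ ha hν => ?_⟩
  obtain ⟨hs, hn⟩ := hM a ν ha hν
  rw [N.sum_weight_mul W U ν hν.from_dest]
  have h1 := max_zero_add_sq_le (u := U.sink) hs
  have h2 : ∑ i with i ≠ N.dest, ∑ l, (N.queueStep γ U a ν).node i l ^ 2 ≤
      ∑ i with i ≠ N.dest, ∑ l, (U.node i l ^ 2 + 2 * (U.node i l *
        (∑ m ∈ Finset.Ici l, N.flowOut ν i m - ∑ m ∈ Finset.Ioi l, N.flowIn ν i m)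
          - (∑ m ∈ Finset.Ici l, a i m) * U.node i l) + M ^ 2) := by
    refine Finset.sum_le_sum fun i hi => Finset.sum_le_sum fun l _ => ?_
    have h := max_zero_add_sq_le (u := U.node i l) (hn i l)
    simp only [queueStep, if_neg (Finset.mem_filter.mp hi).2]
    have h' : U.node i l + ∑ m ∈ Finset.Ici l, N.flowOut ν i m - ∑ m ∈ Finset.Ioi l, N.flowIn ν i m
        - ∑ m ∈ Finset.Ici l, a i m = U.node i l + (∑ m ∈ Finset.Ici l, N.flowOut ν i m
          - ∑ m ∈ Finset.Ioi l, N.flowIn ν i m - ∑ m ∈ Finset.Ici l, a i m) := by ring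
    rw [h']
    linarith
  simp only [Finset.sum_add_distrib, ← Finset.mul_sum, Finset.sum_sub_distrib] at h2
  have h3 : (N.queueStep γ U a ν).sink = max 0 (U.sink + (γ * N.total a - N.delivered ν)) := by
    simp only [queueStep]; congr 1; ring
  simp only [lyapunov, h3]
  linarith

/-- The drift bound compared with a fixed feasible decision. -/
lemma IsDriftConstant.decision_le {N : Network V} {γ Amax B : ℝ} (hB : N.IsDriftConstant γ Amax B)
    {pick : N.Link → (N.Life → ℝ) → N.Life} (hpick : N.IsArgmaxRule pick) (W : ℝ)
    {U : N.VirtualQueues} (hU : U.Nonneg) {a : N.Arrival} (ha : N.PossibleArrival Amax a)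
    {x : N.Flow} (hx : N.FeasibleDecision x) :
    N.lyapunov (N.queueStep γ U a (N.decision pick W U)) - N.lyapunov U
        + W * N.cost (N.decision pick W U) ≤
      B + W * N.cost x + ((γ * N.total a - N.delivered x) * U.sink
        + ∑ i with i ≠ N.dest, ∑ l, (∑ m ∈ Finset.Ici l, N.flowOut x i m
          - ∑ m ∈ Finset.Ioi l, N.flowIn x i m - ∑ m ∈ Finset.Ici l, a i m) * U.node i l) := by
  have h1 := hB W U a _ hU ha (N.decision_feasible pick W U)
  have h2 := N.sum_weight_mul_le_decision hpick W U hx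
  rw [N.sum_weight_mul W U x hx.from_dest] at h2
  simp only [sub_mul _ (∑ m ∈ Finset.Ici _, a _ m), Finset.sum_sub_distrib, mul_comm (U.node _ _)]
    at h2 ⊢
  linarith

end Linear

/-! ### Compactness of the feasible decisions and reduction of a policy to one decision -/

section Stationary

variable {V : Type*} [Fintype V] [DecidableEq V] (N : Network V)

/-- A coordinate of a flow as a continuous linear functional. -/
def coordL (e : N.Link) (l : N.Life) : N.Flow →L[ℝ] ℝ :=
  (ContinuousLinearMap.proj (R := ℝ) (φ := fun _ : N.Life => ℝ) l).comp
    (ContinuousLinearMap.proj (R := ℝ) (φ := fun _ : N.Link => N.Life → ℝ) e)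

omit [Fintype V] [DecidableEq V] in
@[simp]
lemma coordL_apply (e : N.Link) (l : N.Life) (x : N.Flow) : N.coordL e l x = x e l := rfl

/-- The total flow over a link as a continuous linear functional. -/
noncomputable def linkFlowL (e : N.Link) : N.Flow →L[ℝ] ℝ :=
  ∑ l, N.coordL e l

/-- The cost as a continuous linear functional. -/
noncomputable def costL : N.Flow →L[ℝ] ℝ := ∑ e, N.unitCost e • N.linkFlowL e

/-- The flow into a node as a continuous linear functional. -/
noncomputable def flowInL (i : V) (l : N.Life) : N.Flow →L[ℝ] ℝ :=
  ∑ e : N.Link with e.1.2 = i, N.coordL e l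

/-- The flow out of a node as a continuous linear functional. -/
noncomputable def flowOutL (i : V) (l : N.Life) : N.Flow →L[ℝ] ℝ :=
  ∑ e : N.Link with e.1.1 = i, N.coordL e l

omit [Fintype V] [DecidableEq V] in
lemma linkFlowL_apply (e : N.Link) (x : N.Flow) : N.linkFlowL e x = N.linkFlow x e := by
  simp [linkFlowL, linkFlow]

omit [Fintype V] [DecidableEq V] in
lemma costL_apply (x : N.Flow) : N.costL x = N.cost x := by
  simp [costL, cost, linkFlowL_apply]

omit [Fintype V] in
lemma flowInL_apply (i : V) (l : N.Life) (x : N.Flow) : N.flowInL i l x = N.flowIn x i l := by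
  simp [flowInL, flowIn]

omit [Fintype V] in
lemma flowOutL_apply (i : V) (l : N.Life) (x : N.Flow) : N.flowOutL i l x = N.flowOut x i l := by
  simp [flowOutL, flowOut]

omit [Fintype V] [DecidableEq V] in
lemma isClosed_feasibleDecision : IsClosed {x : N.Flow | N.FeasibleDecision x} := by
  have : {x : N.Flow | N.FeasibleDecision x} =
      (⋂ e, ⋂ l, {x | 0 ≤ x e l}) ∩ (⋂ e, {x | N.linkFlowL e x ≤ N.cap e}) ∩
        ⋂ e, ⋂ l, ⋂ _ : e.1.1 = N.dest, {x | x e l = 0} := by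
    ext x
    simp only [linkFlowL_apply, Set.mem_inter_iff, Set.mem_iInter, Set.mem_ofPred_eq]
    exact ⟨fun h => ⟨⟨h.nonneg, h.le_cap⟩, h.from_dest⟩, fun h => ⟨h.1.1, h.1.2, h.2⟩⟩
  rw [this]
  refine (IsClosed.inter ?_ ?_).inter ?_
  · exact isClosed_iInter fun e => isClosed_iInter fun l => isClosed_le (by fun_prop) (by fun_prop)
  · exact isClosed_iInter fun e => isClosed_le (by fun_prop) (by fun_prop)
  · exact isClosed_iInter fun e => isClosed_iInter fun l => isClosed_iInter fun _ =>
      isClosed_eq (by fun_prop) (by fun_prop)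

omit [Fintype V] [DecidableEq V] in
lemma isCompact_feasibleDecision : IsCompact {x : N.Flow | N.FeasibleDecision x} :=
  (isCompact_Icc (a := (0 : N.Flow)) (b := fun e _ => N.cap e)).of_isClosed_subset
    N.isClosed_feasibleDecision fun _ hx =>
      ⟨fun e l => hx.nonneg e l, fun e l => hx.apply_le_cap e l⟩

omit [Fintype V] [DecidableEq V] in
lemma integrable_of_feasible {Ω : Type*} [MeasurableSpace Ω] {P : Measure Ω} [IsFiniteMeasure P]
    {x : Ω → N.Flow} (hm : ∀ e l, Measurable fun ω => x ω e l)
    (hx : ∀ ω, N.FeasibleDecision (x ω)) : Integrable x P := by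
  have hm' : Measurable x := measurable_pi_iff.mpr fun e => measurable_pi_iff.mpr fun l => hm e l
  obtain ⟨C, hC⟩ := N.isCompact_feasibleDecision.isBounded.exists_norm_le
  exact Integrable.of_bound hm'.aestronglyMeasurable C (ae_of_all _ fun ω => hC _ (hx ω))

omit [Fintype V] [DecidableEq V] in
-- All constraints are linear in the flow, so they pass through the expectation.
lemma feasibleDecision_integral {Ω : Type*} [MeasurableSpace Ω] {P : Measure Ω}
    [IsProbabilityMeasure P] {x : Ω → N.Flow} (hm : ∀ e l, Measurable fun ω => x ω e l)
    (hx : ∀ ω, N.FeasibleDecision (x ω)) : N.FeasibleDecision (∫ ω, x ω ∂P) := by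
  have hi := N.integrable_of_feasible (P := P) hm hx
  have hcoord : ∀ e l, (∫ ω, x ω ∂P) e l = ∫ ω, x ω e l ∂P := fun e l =>
    ((N.coordL e l).integral_comp_comm hi).symm
  refine ⟨fun e l => ?_, fun e => ?_, fun e l he => ?_⟩
  · rw [hcoord]
    exact integral_nonneg fun ω => (hx ω).nonneg e l
  · rw [← linkFlowL_apply, ← (N.linkFlowL e).integral_comp_comm hi]
    calc ∫ ω, N.linkFlowL e (x ω) ∂P ≤ ∫ _, N.cap e ∂P :=
          integral_mono ((N.linkFlowL e).integrable_comp hi) (integrable_const _) fun ω => by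
            simpa only [linkFlowL_apply] using (hx ω).le_cap e
      _ = N.cap e := by simp
  · simp [hcoord, (hx _).from_dest e l he]

omit [Fintype V] [DecidableEq V] in
lemma feasibleDecision_average {x : ℕ → N.Flow} (hx : ∀ t, N.FeasibleDecision (x t)) (T : ℕ) :
    N.FeasibleDecision ((T : ℝ)⁻¹ • ∑ t ∈ Finset.range T, x t) := by
  refine ⟨fun e l => ?_, fun e => ?_, fun e l he => ?_⟩
  · simp only [Pi.smul_apply, Finset.sum_apply, smul_eq_mul]
    exact mul_nonneg (by positivity) (Finset.sum_nonneg fun t _ => (hx t).nonneg e l)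
  · rw [← linkFlowL_apply, map_smul, map_sum, smul_eq_mul]
    simp only [linkFlowL_apply]
    -- For `T = 0` the average is the zero flow, since the inverse of zero is zero.
    rcases Nat.eq_zero_or_pos T with rfl | hT
    · simpa using N.cap_nonneg e
    · rw [inv_mul_le_iff₀ (by positivity)]
      simpa using Finset.sum_le_sum (s := Finset.range T) fun t _ => (hx t).le_cap e
  · simp [(hx _).from_dest e l he]

/-- The averages of an admissible policy are attained by one deterministic decision. -/
lemma Admissible.exists_stationary {N : Network V} {lam : N.Arrival} {γ : ℝ} {Ω : Type*}
    [MeasurableSpace Ω] {P : Measure Ω} [IsProbabilityMeasure P] {x : ℕ → Ω → N.Flow}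
    (h : N.Admissible lam γ P x) :
    ∃ y : N.Flow, N.FeasibleDecision y ∧ γ * N.total lam ≤ N.delivered y ∧
      (∀ i, i ≠ N.dest → ∀ l : N.Life, ∑ m ∈ Finset.Ici l, N.flowOut y i m ≤
        ∑ m ∈ Finset.Ioi l, N.flowIn y i m + ∑ m ∈ Finset.Ici l, lam i m) ∧
      ∀ c, HasTimeAvg (fun t => ∫ ω, N.cost (x t ω) ∂P) c → N.cost y = c := by
  have hi := fun t => N.integrable_of_feasible (P := P) (h.measurable t) (h.feasible t)
  set z : ℕ → N.Flow := fun T => (T : ℝ)⁻¹ • ∑ t ∈ Finset.range T, ∫ ω, x t ω ∂P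
  have hz : ∀ T, N.FeasibleDecision (z T) := N.feasibleDecision_average fun t =>
    N.feasibleDecision_integral (h.measurable t) (h.feasible t)
  obtain ⟨y, hy, φ, hφ, hlim⟩ := N.isCompact_feasibleDecision.tendsto_subseq hz
  -- A time average that exists is also the limit along the subsequence `φ`, so one and the same `y`
  -- reproduces all existing averages of linear functionals.
  have key : ∀ (f : N.Flow →L[ℝ] ℝ) (c : ℝ),
      HasTimeAvg (fun t => ∫ ω, f (x t ω) ∂P) c → f y = c := by
    intro f c hc
    have h1 : Tendsto (fun n => f (z (φ n))) atTop (𝓝 (f y)) := (f.continuous.tendsto y).comp hlim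
    refine tendsto_nhds_unique h1 ((hc.comp hφ.tendsto_atTop).congr fun n => ?_)
    simp only [Function.comp_apply, z, map_smul, map_sum, smul_eq_mul]
    rw [div_eq_inv_mul]
    simp_rw [f.integral_comp_comm (hi _)]
  refine ⟨y, hy, ?_, fun i hid l => ?_, fun c hc => ?_⟩
  · obtain ⟨r, hr, hle⟩ := h.reliability
    have := key (∑ l, N.flowInL N.dest l) r (by
      simpa [flowInL_apply, delivered] using hr)
    simp only [sum_apply, flowInL_apply] at this
    rw [delivered, this]
    exact hle
  · obtain ⟨o, r, ho, hr, hle⟩ := h.causality i hid l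
    have ho' := key (∑ m ∈ Finset.Ici l, N.flowOutL i m) o (by
      simpa [flowOutL_apply] using ho)
    have hr' := key (∑ m ∈ Finset.Ioi l, N.flowInL i m) r (by
      simpa [flowInL_apply] using hr)
    simp only [sum_apply, flowOutL_apply, flowInL_apply] at ho' hr'
    rw [ho', hr']
    exact hle
  · rw [← costL_apply]
    exact key N.costL c (by simpa [costL_apply] using hc)

/-- An admissible policy need not have an average cost, but repeating its stationary decision
forever is admissible and has one. Thus `optCost` is not the default value of `sInf` on the empty
set. -/
lemma achievableCosts_nonempty {lam : N.Arrival} {γ : ℝ} (h : (lam, γ) ∈ N.capacityRegion) :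
    (N.achievableCosts lam γ).Nonempty := by
  obtain ⟨Ω, _, P, x, _, hx⟩ := h
  obtain ⟨y, hy, hrel, hcaus, -⟩ := hx.exists_stationary
  have hconst : ∀ c : ℝ, HasTimeAvg (fun _ => c) c := fun c => by
    refine tendsto_const_nhds.congr' ?_
    filter_upwards [eventually_gt_atTop 0] with T hT
    have : (T : ℝ) ≠ 0 := by positivity
    simp [this]
  refine ⟨N.cost y, Unit, inferInstance, Measure.dirac (), fun _ _ => y, inferInstance,
    ⟨fun _ _ _ => measurable_const, fun _ _ => hy, ⟨N.delivered y, ?_, hrel⟩, fun i hi l =>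
      ⟨_, _, ?_, ?_, hcaus i hi l⟩⟩, ?_⟩
  all_goals simpa using hconst _

end Stationary

/-! ### Bounds, measurability and causality of the queue process -/

section QueueDynamics

variable {V : Type*} [Fintype V] [DecidableEq V] (N : Network V)
  {pick : N.Link → (N.Life → ℝ) → N.Life} {γ W : ℝ} {U₀ : N.VirtualQueues}

lemma queues_nonneg (hU₀ : U₀.Nonneg) (α : ℕ → N.Arrival) (t : ℕ) :
    (N.queues pick γ W U₀ α t).Nonneg := by
  cases t with
  | zero => exact hU₀
  | succ t =>
    refine ⟨le_max_left _ _, fun i l => ?_⟩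
    simp only [queues, queueStep]
    split_ifs
    exacts [le_rfl, le_max_left _ _]

lemma queues_congr {α β : ℕ → N.Arrival} {t : ℕ} (h : ∀ s < t, α s = β s) :
    N.queues pick γ W U₀ α t = N.queues pick γ W U₀ β t := by
  induction t with
  | zero => rfl
  | succ t ih =>
    simp only [queues, ih fun s hs => h s (hs.trans t.lt_succ_self), h t t.lt_succ_self]

/-- Growth by at most `M` per slot makes the queues bounded in each fixed slot, hence square
integrable. -/
lemma queues_le (hU₀ : U₀.Nonneg) {Amax M : ℝ} (hM0 : 0 ≤ M)
    (hM : ∀ (a : N.Arrival) (x : N.Flow), N.PossibleArrival Amax a → N.FeasibleDecision x →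
      |γ * N.total a - N.delivered x| ≤ M ∧
      ∀ i l, |∑ m ∈ Finset.Ici l, N.flowOut x i m - ∑ m ∈ Finset.Ioi l, N.flowIn x i m
        - ∑ m ∈ Finset.Ici l, a i m| ≤ M)
    {α : ℕ → N.Arrival} (hα : ∀ t, N.PossibleArrival Amax (α t)) (t : ℕ) :
    (N.queues pick γ W U₀ α t).sink ≤ U₀.sink + t * M ∧
      ∀ i l, (N.queues pick γ W U₀ α t).node i l ≤ U₀.node i l + t * M := by
  induction t with
  | zero => simp [queues]
  | succ t ih =>
    obtain ⟨hs, hn⟩ := hM _ _ (hα t) (N.decision_feasible pick W (N.queues pick γ W U₀ α t))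
    push_cast
    refine ⟨max_le ?_ ?_, fun i l => ?_⟩
    · have := hU₀.sink
      positivity
    · linarith [(abs_le.mp hs).2, ih.1]
    · have h0 : 0 ≤ U₀.node i l + (t + 1) * M := by
        have := hU₀.node i l
        positivity
      simp only [queues, queueStep]
      split_ifs
      · exact h0
      · exact max_le h0 (by linarith [(abs_le.mp (hn i l)).2, ih.2 i l])

omit [Fintype V] in
lemma measurable_decision (hpick : N.IsArgmaxRule pick) {S : Type*} [MeasurableSpace S]
    {U : S → N.VirtualQueues} (hs : Measurable fun α => (U α).sink)
    (hn : ∀ i l, Measurable fun α => (U α).node i l) (e : N.Link) (l : N.Life) :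
    Measurable fun α => N.decision pick W (U α) e l := by
  have hw : Measurable fun α => N.weight W (U α) e := by
    refine measurable_pi_iff.mpr fun m => ?_
    unfold weight
    split_ifs <;> fun_prop
  have hp : Measurable fun α => pick e (N.weight W (U α) e) := (hpick.measurable e).comp hw
  -- There are finitely many lifetimes, so evaluation `(w, l) ↦ w l` is jointly measurable and can
  -- be composed with the random choice of `l`.
  have hval : Measurable fun α => N.weight W (U α) e (pick e (N.weight W (U α) e)) :=
    (measurable_from_prod_countable_left
      (f := fun q : (N.Life → ℝ) × N.Life => q.1 q.2) fun m => measurable_pi_apply m).comp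
        (hw.prodMk hp)
  unfold decision
  refine Measurable.ite ?_ measurable_const measurable_const
  exact (MeasurableSet.const _).inter
    ((measurableSet_eq_fun measurable_const hp).inter (measurableSet_lt measurable_const hval))

/-- `S` is general because two cases are needed: the probability space, for integrability, and the
space of arrival sequences, for independence. -/
lemma measurable_queues (hpick : N.IsArgmaxRule pick) {S : Type*} [MeasurableSpace S]
    {α : ℕ → S → N.Arrival} (hα : ∀ t, Measurable (α t)) (t : ℕ) :
    Measurable (fun ω => (N.queues pick γ W U₀ (fun s => α s ω) t).sink) ∧
      ∀ i l, Measurable (fun ω => (N.queues pick γ W U₀ (fun s => α s ω) t).node i l) := by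
  induction t with
  | zero =>
    simp only [queues]
    exact ⟨measurable_const, fun _ _ => measurable_const⟩
  | succ t ih =>
    have hd := fun e l => N.measurable_decision (W := W) hpick ih.1 ih.2 e l
    have ha : ∀ i l, Measurable fun ω => α t ω i l := fun i l =>
      (measurable_pi_apply l).comp ((measurable_pi_apply i).comp (hα t))
    have ih1 := ih.1
    have ih2 := ih.2
    constructor
    · simp only [queues, queueStep, total, delivered, flowIn]
      fun_prop
    · intro i l
      simp only [queues, queueStep, flowOut, flowIn]
      split_ifs
      · exact measurable_const
      · have := ih2 i l
        fun_prop

variable {N} in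
/-- The queues in a slot depend on the earlier arrivals only. -/
lemma IsIIDArrival.indepFun_queues {Amax : ℝ} {Ω : Type*} [MeasurableSpace Ω] {μ : Measure Ω}
    {a : ℕ → Ω → N.Arrival} (ha : N.IsIIDArrival Amax μ a) {u : N.VirtualQueues → ℝ} {t : ℕ}
    (hu : Measurable fun α : ℕ → N.Arrival => u (N.queues pick γ W U₀ α t))
    {g : N.Arrival → ℝ} (hg : Measurable g) :
    IndepFun (fun ω => g (a t ω)) (fun ω => u (N.queues pick γ W U₀ (fun s => a s ω) t)) μ := by
  have h := ha.indep.indepFun_finset {t} (Finset.range t) (by simp) ha.measurable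
  -- Padding the first `t` arrivals with zeros presents the queues as a function of the past alone;
  -- by `queues_congr` the padding has no effect in slot `t`.
  let ext : (Finset.range t → N.Arrival) → ℕ → N.Arrival :=
    fun β s => if hs : s ∈ Finset.range t then β ⟨s, hs⟩ else 0
  have hext : Measurable ext := by
    refine measurable_pi_iff.mpr fun s => ?_
    by_cases hs : s ∈ Finset.range t
    · simp only [ext, dif_pos hs]
      exact measurable_pi_apply _
    · simp only [ext, dif_neg hs]
      exact measurable_const
  have h' := h.comp (hg.comp (measurable_pi_apply (⟨t, by simp⟩ : ({t} : Finset ℕ))))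
    (hu.comp hext)
  refine h'.congr (ae_of_all _ fun ω => rfl) (ae_of_all _ fun ω => ?_)
  simp only [Function.comp_apply]
  rw [N.queues_congr (β := fun s => a s ω)]
  intro s hs
  simp [ext, hs]

end QueueDynamics

end Network

end DelayNet

namespace DelayNet

/-- The hypothesis says that `q` is `O(√T)`; it is used with `q` a mean queue length. -/
lemma tendsto_div_of_sq_le {q : ℕ → ℝ} {b c : ℝ} (hq : ∀ T, 0 ≤ q T)
    (h : ∀ T : ℕ, q T ^ 2 ≤ b + T * c) : Tendsto (fun T : ℕ => q T / T) atTop (𝓝 0) := by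
  have hsq : Tendsto (fun T : ℕ => (q T / T) ^ 2) atTop (𝓝 0) := by
    have hlim : Tendsto (fun T : ℕ => b / (T : ℝ) * (1 / T) + c / T) atTop (𝓝 (0 * 0 + 0)) :=
      ((tendsto_const_div_atTop_nhds_zero_nat b).mul
        (tendsto_const_div_atTop_nhds_zero_nat 1)).add (tendsto_const_div_atTop_nhds_zero_nat c)
    rw [mul_zero, add_zero] at hlim
    refine squeeze_zero' (Eventually.of_forall fun T => sq_nonneg _) ?_ hlim
    filter_upwards [eventually_gt_atTop 0] with T hT
    have hT' : (0 : ℝ) < T := Nat.cast_pos.mpr hT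
    rw [div_pow, div_le_iff₀ (by positivity)]
    refine (h T).trans (le_of_eq ?_)
    field_simp
  have := hsq.sqrt
  rw [Real.sqrt_zero] at this
  exact this.congr fun T => Real.sqrt_sq (div_nonneg (hq T) T.cast_nonneg)

lemma sq_integral_le_integral_sq {Ω : Type*} [MeasurableSpace Ω] {μ : Measure Ω}
    [IsProbabilityMeasure μ] {X : Ω → ℝ} (hX : MemLp X 2 μ) :
    (∫ ω, X ω ∂μ) ^ 2 ≤ ∫ ω, X ω ^ 2 ∂μ := by
  have h := variance_nonneg X μ
  rw [variance_eq_sub hX] at h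
  simpa using h

namespace Network

/-! ### Expected drift, queue moments and delivery shortfall -/

section Expectation

variable {V : Type*} [Fintype V] [DecidableEq V] {N : Network V}
  {pick : N.Link → (N.Life → ℝ) → N.Life} {γ Amax W : ℝ} {U₀ : N.VirtualQueues}
  {Ω : Type*} [MeasurableSpace Ω] {μ : Measure Ω} [IsProbabilityMeasure μ]
  {a : ℕ → Ω → N.Arrival}

omit [Fintype V] [DecidableEq V] in
lemma IsIIDArrival.integral_comp_eq {Ω : Type*} [MeasurableSpace Ω] {μ : Measure Ω}
    {a : ℕ → Ω → N.Arrival} (ha : N.IsIIDArrival Amax μ a) {g : N.Arrival → ℝ} (hg : Measurable g)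
    (t : ℕ) : ∫ ω, g (a t ω) ∂μ = ∫ ω, g (a 0 ω) ∂μ :=
  ((ha.identDistrib t).comp hg).integral_eq

omit [Fintype V] [DecidableEq V] in
lemma measurable_arrival_apply (i : V) (l : N.Life) : Measurable fun b : N.Arrival => b i l :=
  (measurable_pi_apply l).comp (measurable_pi_apply i)

omit [Fintype V] [DecidableEq V] in
lemma IsIIDArrival.integrable_apply (ha : N.IsIIDArrival Amax μ a) (t : ℕ) (i : V) (l : N.Life) :
    Integrable (fun ω => a t ω i l) μ := by
  refine Integrable.of_bound
    ((measurable_arrival_apply i l).comp (ha.measurable t)).aestronglyMeasurable Amax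
    (ae_of_all _ fun ω => ?_)
  rw [Real.norm_of_nonneg ((ha.possible t ω).nonneg i l)]
  exact (ha.possible t ω).le_max i l

omit [DecidableEq V] in
lemma IsIIDArrival.integrable_total (ha : N.IsIIDArrival Amax μ a) (t : ℕ) :
    Integrable (fun ω => N.total (a t ω)) μ :=
  integrable_finsetSum _ fun i _ => integrable_finsetSum _ fun l _ => ha.integrable_apply t i l

omit [DecidableEq V] in
lemma IsIIDArrival.integral_total (ha : N.IsIIDArrival Amax μ a) (t : ℕ) :
    ∫ ω, N.total (a t ω) ∂μ = N.total (N.meanRate μ a) := by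
  have hm : Measurable fun b : N.Arrival => N.total b :=
    Finset.measurable_fun_sum _ fun i _ => Finset.measurable_fun_sum _ fun l _ =>
      measurable_arrival_apply i l
  rw [ha.integral_comp_eq hm]
  simp only [total, meanRate]
  rw [integral_finsetSum _ fun i _ => integrable_finsetSum _ fun l _ => ha.integrable_apply 0 i l]
  exact Finset.sum_congr rfl fun i _ => integral_finsetSum _ fun l _ => ha.integrable_apply 0 i l

lemma IsIIDArrival.memLp_queues (ha : N.IsIIDArrival Amax μ a) (hpick : N.IsArgmaxRule pick)
    (hU₀ : U₀.Nonneg) (t : ℕ) :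
    MemLp (fun ω => (N.queues pick γ W U₀ (fun s => a s ω) t).sink) 2 μ ∧
      ∀ i l, MemLp (fun ω => (N.queues pick γ W U₀ (fun s => a s ω) t).node i l) 2 μ := by
  obtain ⟨M, hM0, hM⟩ := N.exists_increment_bound γ Amax
  have hm := N.measurable_queues (γ := γ) (W := W) (U₀ := U₀) hpick ha.measurable t
  have hnn := fun ω => N.queues_nonneg (pick := pick) (γ := γ) (W := W) hU₀ (fun s => a s ω) t
  have hle := fun ω => N.queues_le (pick := pick) (γ := γ) (W := W) hU₀ hM0 hM
    (fun s => ha.possible s ω) t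
  refine ⟨MemLp.of_bound hm.1.aestronglyMeasurable (U₀.sink + t * M)
    (ae_of_all _ fun ω => ?_), fun i l =>
    MemLp.of_bound (hm.2 i l).aestronglyMeasurable (U₀.node i l + t * M)
      (ae_of_all _ fun ω => ?_)⟩
  · rw [Real.norm_of_nonneg (hnn ω).sink]
    exact (hle ω).1
  · rw [Real.norm_of_nonneg ((hnn ω).node i l)]
    exact (hle ω).2 i l

lemma IsIIDArrival.integrable_algFlow (ha : N.IsIIDArrival Amax μ a)
    (hpick : N.IsArgmaxRule pick) (t : ℕ) :
    Integrable (fun ω => N.algFlow pick γ W U₀ (fun s => a s ω) t) μ := by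
  have hm := N.measurable_queues (γ := γ) (W := W) (U₀ := U₀) hpick ha.measurable t
  exact N.integrable_of_feasible (N.measurable_decision hpick hm.1 hm.2)
    fun ω => N.decision_feasible pick W _

omit [Fintype V] [DecidableEq V] [IsProbabilityMeasure μ] in
lemma integrable_cost {x : Ω → N.Flow} (hx : Integrable x μ) :
    Integrable (fun ω => N.cost (x ω)) μ := by
  simpa only [costL_apply] using N.costL.integrable_comp hx

omit [Fintype V] [IsProbabilityMeasure μ] in
lemma integrable_delivered {x : Ω → N.Flow} (hx : Integrable x μ) :
    Integrable (fun ω => N.delivered (x ω)) μ :=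
  integrable_finsetSum _ fun l _ => by
    simpa only [flowInL_apply] using (N.flowInL N.dest l).integrable_comp hx

lemma IsIIDArrival.integrable_lyapunov (ha : N.IsIIDArrival Amax μ a)
    (hpick : N.IsArgmaxRule pick) (hU₀ : U₀.Nonneg) (t : ℕ) :
    Integrable (fun ω => N.lyapunov (N.queues pick γ W U₀ (fun s => a s ω) t)) μ := by
  have h := ha.memLp_queues (γ := γ) (W := W) hpick hU₀ t
  exact (h.1.integrable_sq.add (integrable_finsetSum _ fun i _ =>
    integrable_finsetSum _ fun l _ => (h.2 i l).integrable_sq)).div_const 2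

omit [IsProbabilityMeasure μ] in
/-- A function of the current arrivals of nonpositive mean has nonpositive correlation with a
nonnegative function of the queues. -/
lemma IsIIDArrival.integral_mul_queues_nonpos (ha : N.IsIIDArrival Amax μ a)
    {u : N.VirtualQueues → ℝ} {t : ℕ}
    (hu : Measurable fun α : ℕ → N.Arrival => u (N.queues pick γ W U₀ α t))
    (hui : Integrable (fun ω => u (N.queues pick γ W U₀ (fun s => a s ω) t)) μ)
    (hu0 : ∀ ω, 0 ≤ u (N.queues pick γ W U₀ (fun s => a s ω) t))
    {g : N.Arrival → ℝ} (hg : Measurable g) (hgi : Integrable (fun ω => g (a t ω)) μ)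
    (hg0 : ∫ ω, g (a t ω) ∂μ ≤ 0) :
    Integrable (fun ω => g (a t ω) * u (N.queues pick γ W U₀ (fun s => a s ω) t)) μ ∧
      ∫ ω, g (a t ω) * u (N.queues pick γ W U₀ (fun s => a s ω) t) ∂μ ≤ 0 := by
  have h := ha.indepFun_queues hu hg
  refine ⟨h.integrable_mul hgi hui, ?_⟩
  rw [h.integral_fun_mul_eq_mul_integral hgi.aestronglyMeasurable hui.aestronglyMeasurable]
  exact mul_nonpos_of_nonpos_of_nonneg hg0 (integral_nonneg hu0)

/-- The expected drift plus penalty in one slot. -/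
lemma IsIIDArrival.integral_drift_le (ha : N.IsIIDArrival Amax μ a)
    (hpick : N.IsArgmaxRule pick) (hU₀ : U₀.Nonneg) {B : ℝ} (hB : N.IsDriftConstant γ Amax B)
    {y : N.Flow} (hy : N.FeasibleDecision y)
    (hrel : γ * N.total (N.meanRate μ a) ≤ N.delivered y)
    (hcaus : ∀ i, i ≠ N.dest → ∀ l : N.Life, ∑ m ∈ Finset.Ici l, N.flowOut y i m ≤
      ∑ m ∈ Finset.Ioi l, N.flowIn y i m + ∑ m ∈ Finset.Ici l, N.meanRate μ a i m) (t : ℕ) :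
    ∫ ω, N.lyapunov (N.queues pick γ W U₀ (fun s => a s ω) (t + 1)) ∂μ
      - ∫ ω, N.lyapunov (N.queues pick γ W U₀ (fun s => a s ω) t) ∂μ
      + W * ∫ ω, N.cost (N.algFlow pick γ W U₀ (fun s => a s ω) t) ∂μ ≤ B + W * N.cost y := by
  have hmeas := N.measurable_queues (γ := γ) (W := W) (U₀ := U₀) hpick
    (S := ℕ → N.Arrival) (α := fun s α => α s) (fun s => measurable_pi_apply s) t
  have hLp := ha.memLp_queues (γ := γ) (W := W) hpick hU₀ t
  have hnn := fun ω => N.queues_nonneg (pick := pick) (γ := γ) (W := W) hU₀ (fun s => a s ω) t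
  have hai := ha.integrable_apply t
  have hmap := measurable_arrival_apply (N := N)
  -- Reliability of `y` makes the arrival factor nonpositive in mean. In `hn` causality does the
  -- same for the other queues, after the means in slot `t` are replaced by those in slot `0`.
  have hs := ha.integral_mul_queues_nonpos (u := fun U => U.sink) hmeas.1
    (hLp.1.integrable one_le_two) (fun ω => (hnn ω).sink)
    (g := fun b => γ * N.total b - N.delivered y) (by unfold total; fun_prop)
    (((ha.integrable_total t).const_mul γ).sub (integrable_const _)) (by
      rw [integral_sub ((ha.integrable_total t).const_mul γ) (integrable_const _),
        integral_const_mul, ha.integral_total]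
      simpa using hrel)
  have hn : ∀ i, i ≠ N.dest → ∀ l, _ := fun i hi l =>
    ha.integral_mul_queues_nonpos (u := fun U => U.node i l) (hmeas.2 i l)
    ((hLp.2 i l).integrable one_le_two) (fun ω => (hnn ω).node i l)
    (g := fun b => ∑ m ∈ Finset.Ici l, N.flowOut y i m - ∑ m ∈ Finset.Ioi l, N.flowIn y i m
      - ∑ m ∈ Finset.Ici l, b i m) (by fun_prop)
    ((integrable_const _).sub (integrable_finsetSum _ fun m _ => hai i m)) (by
      rw [integral_sub (integrable_const _) (integrable_finsetSum _ fun m _ => hai i m),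
        integral_finsetSum _ fun m _ => hai i m]
      simp_rw [fun m => ha.integral_comp_eq (hmap i m) t]
      have := hcaus i hi l
      simp only [meanRate] at this
      simp only [integral_const, probReal_univ, one_smul]
      linarith)
  have hL := ha.integrable_lyapunov (γ := γ) (W := W) hpick hU₀
  have hc := integrable_cost (ha.integrable_algFlow (γ := γ) (W := W) (U₀ := U₀) hpick t)
  have hni : ∀ i ∈ Finset.univ.filter (· ≠ N.dest), _ := fun i hi =>
    integrable_finsetSum Finset.univ fun l _ => (hn i (Finset.mem_filter.mp hi).2 l).1
  have hΔ : Integrable (fun ω => N.lyapunov (N.queues pick γ W U₀ (fun s => a s ω) (t + 1))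
      - N.lyapunov (N.queues pick γ W U₀ (fun s => a s ω) t)) μ := (hL _).sub (hL _)
  rw [← integral_const_mul, ← integral_sub (hL _) (hL _), ← integral_add hΔ (hc.const_mul W)]
  have hR : Integrable (fun ω => (γ * N.total (a t ω) - N.delivered y)
      * (N.queues pick γ W U₀ (fun s => a s ω) t).sink
      + ∑ i with i ≠ N.dest, ∑ l, (∑ m ∈ Finset.Ici l, N.flowOut y i m
        - ∑ m ∈ Finset.Ioi l, N.flowIn y i m - ∑ m ∈ Finset.Ici l, a t ω i m)
        * (N.queues pick γ W U₀ (fun s => a s ω) t).node i l) μ :=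
    hs.1.add (integrable_finsetSum _ hni)
  refine (integral_mono (hΔ.add (hc.const_mul W))
    ((integrable_const (B + W * N.cost y)).add hR) fun ω =>
      hB.decision_le hpick W (hnn ω) (ha.possible t ω) hy).trans ?_
  rw [integral_add' (integrable_const _) hR, integral_add hs.1 (integrable_finsetSum _ hni),
    integral_finsetSum _ hni]
  have hsum : ∑ i with i ≠ N.dest, ∫ ω, ∑ l, (∑ m ∈ Finset.Ici l, N.flowOut y i m
      - ∑ m ∈ Finset.Ioi l, N.flowIn y i m - ∑ m ∈ Finset.Ici l, a t ω i m)
        * (N.queues pick γ W U₀ (fun s => a s ω) t).node i l ∂μ ≤ 0 := by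
    refine Finset.sum_nonpos fun i hi => ?_
    have hi' := (Finset.mem_filter.mp hi).2
    rw [integral_finsetSum _ fun l _ => (hn i hi' l).1]
    exact Finset.sum_nonpos fun l _ => (hn i hi' l).2
  have := hs.2
  simp only [integral_const, probReal_univ, one_smul]
  linarith

/-- The expected drift plus penalty over a time horizon. -/
lemma IsIIDArrival.integral_lyapunov_le (ha : N.IsIIDArrival Amax μ a)
    (hpick : N.IsArgmaxRule pick) (hU₀ : U₀.Nonneg) {B : ℝ} (hB : N.IsDriftConstant γ Amax B)
    {y : N.Flow} (hy : N.FeasibleDecision y)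
    (hrel : γ * N.total (N.meanRate μ a) ≤ N.delivered y)
    (hcaus : ∀ i, i ≠ N.dest → ∀ l : N.Life, ∑ m ∈ Finset.Ici l, N.flowOut y i m ≤
      ∑ m ∈ Finset.Ioi l, N.flowIn y i m + ∑ m ∈ Finset.Ici l, N.meanRate μ a i m) (T : ℕ) :
    ∫ ω, N.lyapunov (N.queues pick γ W U₀ (fun s => a s ω) T) ∂μ
      + W * ∑ t ∈ Finset.range T, ∫ ω, N.cost (N.algFlow pick γ W U₀ (fun s => a s ω) t) ∂μ ≤
      N.lyapunov U₀ + T * (B + W * N.cost y) := by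
  induction T with
  | zero => simp [queues]
  | succ T ih =>
    have := ha.integral_drift_le (W := W) hpick hU₀ hB hy hrel hcaus T
    rw [Finset.sum_range_succ]
    push_cast
    linarith

omit [IsProbabilityMeasure μ] in
lemma sum_integral_cost_nonneg (a : ℕ → Ω → N.Arrival) (T : ℕ) :
    0 ≤ ∑ t ∈ Finset.range T, ∫ ω, N.cost (N.algFlow pick γ W U₀ (fun s => a s ω) t) ∂μ :=
  Finset.sum_nonneg fun _ _ => integral_nonneg fun _ => (N.decision_feasible pick W _).cost_nonneg

/-- The squared mean of a virtual queue is at most twice the mean of the Lyapunov function. -/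
lemma IsIIDArrival.sq_integral_queues_le (ha : N.IsIIDArrival Amax μ a)
    (hpick : N.IsArgmaxRule pick) (hU₀ : U₀.Nonneg) (t : ℕ) :
    (∫ ω, (N.queues pick γ W U₀ (fun s => a s ω) t).sink ∂μ) ^ 2 ≤
        2 * ∫ ω, N.lyapunov (N.queues pick γ W U₀ (fun s => a s ω) t) ∂μ ∧
      ∀ i, i ≠ N.dest → ∀ l, (∫ ω, (N.queues pick γ W U₀ (fun s => a s ω) t).node i l ∂μ) ^ 2 ≤
        2 * ∫ ω, N.lyapunov (N.queues pick γ W U₀ (fun s => a s ω) t) ∂μ := by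
  have h := ha.memLp_queues (γ := γ) (W := W) hpick hU₀ t
  have hL := (ha.integrable_lyapunov (γ := γ) (W := W) hpick hU₀ t).const_mul 2
  have hlyap : ∀ U : N.VirtualQueues,
      2 * N.lyapunov U = U.sink ^ 2 + ∑ i with i ≠ N.dest, ∑ l, U.node i l ^ 2 := fun U => by
    unfold lyapunov; ring
  have hrow : ∀ (U : N.VirtualQueues) i, 0 ≤ ∑ l, U.node i l ^ 2 := fun U i =>
    Finset.sum_nonneg fun l _ => sq_nonneg _
  rw [← integral_const_mul]
  constructor
  · refine (sq_integral_le_integral_sq h.1).trans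
      (integral_mono h.1.integrable_sq hL fun ω => ?_)
    simp only [hlyap]
    exact le_add_of_nonneg_right (Finset.sum_nonneg fun i _ => hrow _ i)
  · intro i hi l
    refine (sq_integral_le_integral_sq (h.2 i l)).trans
      (integral_mono (h.2 i l).integrable_sq hL fun ω => ?_)
    simp only [hlyap]
    set U := N.queues pick γ W U₀ (fun s => a s ω) t
    calc U.node i l ^ 2 ≤ ∑ l, U.node i l ^ 2 :=
          Finset.single_le_sum (f := fun l => U.node i l ^ 2) (fun _ _ => sq_nonneg _)
            (Finset.mem_univ l)
      _ ≤ ∑ i with i ≠ N.dest, ∑ l, U.node i l ^ 2 :=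
          Finset.single_le_sum (f := fun i => ∑ l, U.node i l ^ 2) (fun i _ => hrow U i)
            (by simpa using hi)
      _ ≤ _ := le_add_of_nonneg_left (sq_nonneg _)

/-- The shortfall in expected delivery is stored in the queue of the destination. -/
lemma IsIIDArrival.shortfall_le (ha : N.IsIIDArrival Amax μ a) (hpick : N.IsArgmaxRule pick)
    (hU₀ : U₀.Nonneg) (T : ℕ) :
    T * (γ * N.total (N.meanRate μ a))
      - ∑ t ∈ Finset.range T, ∫ ω, N.delivered (N.algFlow pick γ W U₀ (fun s => a s ω) t) ∂μ ≤
      ∫ ω, (N.queues pick γ W U₀ (fun s => a s ω) T).sink ∂μ := by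
  induction T with
  | zero => simpa [queues] using hU₀.sink
  | succ T ih =>
    have hi := fun t =>
      (ha.memLp_queues (γ := γ) (W := W) hpick hU₀ t).1.integrable one_le_two
    have hd := integrable_delivered (ha.integrable_algFlow (γ := γ) (W := W) (U₀ := U₀) hpick T)
    have hA := (ha.integrable_total T).const_mul γ
    have hiA : Integrable (fun ω => (N.queues pick γ W U₀ (fun s => a s ω) T).sink
        + γ * N.total (a T ω)) μ := (hi T).add hA
    -- The truncated queue dominates the untruncated update, which telescopes in mean.
    have hstep : ∫ ω, ((N.queues pick γ W U₀ (fun s => a s ω) T).sink + γ * N.total (a T ω)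
        - N.delivered (N.algFlow pick γ W U₀ (fun s => a s ω) T)) ∂μ ≤
        ∫ ω, (N.queues pick γ W U₀ (fun s => a s ω) (T + 1)).sink ∂μ :=
      integral_mono (hiA.sub hd) (hi (T + 1)) fun ω => le_max_right _ _
    rw [integral_sub hiA hd, integral_add (hi T) hA, integral_const_mul,
      ha.integral_total] at hstep
    rw [Finset.sum_range_succ]
    push_cast
    linarith

omit [IsProbabilityMeasure μ] in
-- One valid time makes the set nonempty, so its infimum in `ℕ∞` is attained at the least element.
lemma exists_convergenceTime_eq {lam : N.Arrival} {ν : ℕ → Ω → N.Flow} {ε : ℝ} {n : ℕ}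
    (hn : 1 ≤ n) (h : ∀ s : ℕ, n ≤ s →
      γ * N.total lam - ∑ t ∈ Finset.range s, (∫ ω, N.delivered (ν t ω) ∂μ) / (s : ℝ) ≤ ε) :
    ∃ τ : ℕ, N.convergenceTime lam γ μ ν ε = (τ : ℕ∞) ∧ τ ≤ n := by
  classical
  have hex : ∃ τ : ℕ, 1 ≤ τ ∧ ∀ s : ℕ, τ ≤ s →
      γ * N.total lam - ∑ t ∈ Finset.range s, (∫ ω, N.delivered (ν t ω) ∂μ) / (s : ℝ) ≤ ε :=
    ⟨n, hn, h⟩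
  have hle : ∀ m ∈ {τ : ℕ | 1 ≤ τ ∧ ∀ s : ℕ, τ ≤ s →
      γ * N.total lam - ∑ t ∈ Finset.range s, (∫ ω, N.delivered (ν t ω) ∂μ) / (s : ℝ) ≤ ε},
      N.convergenceTime lam γ μ ν ε ≤ (m : ℕ∞) := fun m hm => iInf₂_le m hm
  refine ⟨Nat.find hex, le_antisymm (hle _ (Nat.find_spec hex)) ?_, Nat.find_min' hex ⟨hn, h⟩⟩
  exact le_iInf₂ fun m hm => Nat.cast_le.mpr (Nat.find_min' hex hm)

end Expectation

/-! ### Stability, convergence time and cost -/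

section Guarantees

variable {V : Type*} [Fintype V] [DecidableEq V] {N : Network V}
  {pick : N.Link → (N.Life → ℝ) → N.Life} {γ Amax : ℝ} {U₀ : N.VirtualQueues}
  {Ω : Type*} [MeasurableSpace Ω] {μ : Measure Ω} [IsProbabilityMeasure μ]
  {a : ℕ → Ω → N.Arrival}

/-- Costs are nonnegative and can be dropped from the telescoped bound. Both constants are fixed
before `W`, which is what makes the convergence time linear in `W`. -/
lemma IsIIDArrival.exists_two_mul_lyapunov_le (ha : N.IsIIDArrival Amax μ a)
    (hcap : (N.meanRate μ a, γ) ∈ N.capacityRegion) (hpick : N.IsArgmaxRule pick)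
    (hU₀ : U₀.Nonneg) : ∃ b c : ℝ, 0 ≤ c ∧ ∀ W : ℝ, 0 ≤ W → ∀ T : ℕ,
      2 * ∫ ω, N.lyapunov (N.queues pick γ W U₀ (fun s => a s ω) T) ∂μ ≤
        2 * N.lyapunov U₀ + T * (b + W * c) := by
  obtain ⟨Ω', _, P, x, _, hx⟩ := hcap
  obtain ⟨y, hy, hrel, hcaus, -⟩ := hx.exists_stationary
  obtain ⟨B, hB⟩ := N.exists_isDriftConstant γ Amax
  refine ⟨2 * B, 2 * N.cost y, mul_nonneg two_pos.le hy.cost_nonneg, fun W hW T => ?_⟩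
  have h := ha.integral_lyapunov_le (W := W) hpick hU₀ hB hy hrel hcaus T
  have h0 := mul_nonneg hW (sum_integral_cost_nonneg (pick := pick) (γ := γ) (W := W) (U₀ := U₀)
    (μ := μ) a T)
  linarith

lemma IsIIDArrival.meanRateStable_queues (ha : N.IsIIDArrival Amax μ a)
    (hcap : (N.meanRate μ a, γ) ∈ N.capacityRegion) (hpick : N.IsArgmaxRule pick)
    (hU₀ : U₀.Nonneg) {W : ℝ} (hW : 0 ≤ W) :
    MeanRateStable μ (fun t ω => (N.queues pick γ W U₀ (fun s => a s ω) t).sink) ∧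
      ∀ i, i ≠ N.dest → ∀ l, MeanRateStable μ
        (fun t ω => (N.queues pick γ W U₀ (fun s => a s ω) t).node i l) := by
  obtain ⟨b, c, -, hbc⟩ := ha.exists_two_mul_lyapunov_le hcap hpick hU₀
  have hLp := ha.memLp_queues (γ := γ) (W := W) hpick hU₀
  have hsq := ha.sq_integral_queues_le (γ := γ) (W := W) hpick hU₀
  have hnn := fun t ω => N.queues_nonneg (pick := pick) (γ := γ) (W := W) hU₀ (fun s => a s ω) t
  exact ⟨⟨fun t => (hLp t).1.integrable one_le_two,
      tendsto_div_of_sq_le (fun T => integral_nonneg fun ω => (hnn T ω).sink)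
        fun T => (hsq T).1.trans (hbc W hW T)⟩,
    fun i hi l => ⟨fun t => ((hLp t).2 i l).integrable one_le_two,
      tendsto_div_of_sq_le (fun T => integral_nonneg fun ω => (hnn T ω).node i l)
        fun T => ((hsq T).2 i hi l).trans (hbc W hW T)⟩⟩

/-- For `s ≥ 1` and `W ≥ 1` the squared mean destination queue is at most `s * D * W`, and this is
at most `(ε * s) ^ 2` once `s ≥ D * W / ε ^ 2`. -/
lemma IsIIDArrival.exists_convergenceTime_le (ha : N.IsIIDArrival Amax μ a)
    (hcap : (N.meanRate μ a, γ) ∈ N.capacityRegion) (hpick : N.IsArgmaxRule pick)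
    (hU₀ : U₀.Nonneg) {ε : ℝ} (hε : 0 < ε) : ∃ K : ℝ, ∀ W : ℝ, 1 ≤ W → ∃ τ : ℕ,
      N.convergenceTime (N.meanRate μ a) γ μ
        (fun t ω => N.algFlow pick γ W U₀ (fun s => a s ω) t) ε = (τ : ℕ∞) ∧
      (τ : ℝ) ≤ K * W := by
  obtain ⟨b, c, hc, hbc⟩ := ha.exists_two_mul_lyapunov_le hcap hpick hU₀
  have hL0 : 0 ≤ N.lyapunov U₀ := by
    unfold lyapunov
    positivity
  set D : ℝ := 2 * N.lyapunov U₀ + |b| + c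
  have hD : 0 ≤ D := by positivity
  -- The `2` pays for rounding up and for the extra slot that ensures `s ≥ 1`; both are absorbed
  -- because `W ≥ 1`.
  refine ⟨D / ε ^ 2 + 2, fun W hW => ?_⟩
  have hn : (⌈D / ε ^ 2 * W⌉₊ + 1 : ℕ) ≤ (D / ε ^ 2 + 2) * W := by
    have := Nat.ceil_lt_add_one (a := D / ε ^ 2 * W) (by positivity)
    push_cast
    linarith
  suffices h : ∀ s : ℕ, ⌈D / ε ^ 2 * W⌉₊ + 1 ≤ s → γ * N.total (N.meanRate μ a)
      - ∑ t ∈ Finset.range s,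
        (∫ ω, N.delivered (N.algFlow pick γ W U₀ (fun s => a s ω) t) ∂μ) / (s : ℝ) ≤ ε by
    obtain ⟨τ, hτ, hle⟩ := exists_convergenceTime_eq (by omega) h
    exact ⟨τ, hτ, (Nat.cast_le.mpr hle).trans hn⟩
  intro s hs
  have hs1 : (1 : ℝ) ≤ s := by exact_mod_cast (by omega : 1 ≤ s)
  have hs0 : (0 : ℝ) < s := by linarith
  have hsD : D * W ≤ ε ^ 2 * s := by
    have h1 : D / ε ^ 2 * W ≤ s :=
      (Nat.le_ceil _).trans (Nat.cast_le.mpr (by omega))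
    rw [div_mul_eq_mul_div, div_le_iff₀ (by positivity)] at h1
    linarith
  have hsink : ∫ ω, (N.queues pick γ W U₀ (fun s => a s ω) s).sink ∂μ ≤ ε * s := by
    refine le_of_sq_le_sq ?_ (by positivity)
    refine ((ha.sq_integral_queues_le (γ := γ) (W := W) hpick hU₀ s).1.trans
      (hbc W (by linarith) s)).trans ?_
    have hb : b ≤ |b| * W := (le_abs_self b).trans (le_mul_of_one_le_right (abs_nonneg b) hW)
    have hl : 2 * N.lyapunov U₀ ≤ s * (2 * N.lyapunov U₀ * W) := by
      have h1 : 2 * N.lyapunov U₀ ≤ 2 * N.lyapunov U₀ * W :=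
        le_mul_of_one_le_right (by positivity) hW
      exact h1.trans (le_mul_of_one_le_left (by positivity) hs1)
    calc 2 * N.lyapunov U₀ + s * (b + W * c)
        ≤ s * (2 * N.lyapunov U₀ * W) + s * (|b| * W + W * c) := by gcongr
      _ = s * (D * W) := by simp only [D]; ring
      _ ≤ s * (ε ^ 2 * s) := by gcongr
      _ = (ε * s) ^ 2 := by ring
  have hshort := ha.shortfall_le (γ := γ) (W := W) hpick hU₀ s
  rw [← Finset.sum_div, sub_le_iff_le_add, ← sub_le_iff_le_add', le_div_iff₀ hs0]
  linarith

lemma IsIIDArrival.limsup_cost_le (ha : N.IsIIDArrival Amax μ a)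
    (hcap : (N.meanRate μ a, γ) ∈ N.capacityRegion) (hpick : N.IsArgmaxRule pick)
    (hU₀ : U₀.Nonneg) {B : ℝ} (hB : N.IsDriftConstant γ Amax B) {W : ℝ} (hW : 0 < W) :
    limsup (fun T : ℕ => (∑ t ∈ Finset.range T,
        ∫ ω, N.cost (N.algFlow pick γ W U₀ (fun s => a s ω) t) ∂μ) / (T : ℝ)) atTop
      ≤ N.optCost (N.meanRate μ a) γ + B / W := by
  -- With `B / W` moved to the left, the infimum can be treated one policy at a time, each with its
  -- own `y`.
  rw [← sub_le_iff_le_add]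
  refine le_csInf (N.achievableCosts_nonempty hcap) ?_
  rintro c ⟨Ω', _, P, x, _, hx, hc⟩
  obtain ⟨y, hy, hrel, hcaus, hcost⟩ := hx.exists_stationary
  obtain rfl := hcost c hc
  rw [sub_le_iff_le_add]
  have hlim : Tendsto (fun T : ℕ => N.lyapunov U₀ / W / (T : ℝ) + (N.cost y + B / W)) atTop
      (𝓝 (0 + (N.cost y + B / W))) :=
    (tendsto_const_div_atTop_nhds_zero_nat _).add_const _
  rw [zero_add] at hlim
  rw [← hlim.limsup_eq]
  refine limsup_le_limsup ?_ ?_ hlim.isBoundedUnder_le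
  · filter_upwards [eventually_gt_atTop 0] with T hT
    have hT' : (0 : ℝ) < T := Nat.cast_pos.mpr hT
    have h := ha.integral_lyapunov_le (W := W) hpick hU₀ hB hy hrel hcaus T
    have h0 : 0 ≤ ∫ ω, N.lyapunov (N.queues pick γ W U₀ (fun s => a s ω) T) ∂μ :=
      integral_nonneg fun ω => by
        unfold lyapunov
        positivity
    rw [div_le_iff₀ hT', ← mul_le_mul_iff_right₀ hW]
    refine (le_of_add_le_of_nonneg_right h h0).trans (le_of_eq ?_)
    field_simp
    ring
  -- Nonnegative costs supply the lower bound that the real `limsup` needs for monotonicity.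
  · exact isCoboundedUnder_le_of_le atTop (x := 0) fun T =>
      div_nonneg (sum_integral_cost_nonneg a T) T.cast_nonneg

end Guarantees

end Network

end DelayNet

theorem proposition4 {V : Type*} [Fintype V] [DecidableEq V] (N : DelayNet.Network V)
    (γ Amax : ℝ) {Ω : Type*} [MeasurableSpace Ω] (μ : Measure Ω) [IsProbabilityMeasure μ]
    (a : ℕ → Ω → N.Arrival) (ha : N.IsIIDArrival Amax μ a)
    (hcap : (N.meanRate μ a, γ) ∈ N.capacityRegion)
    (pick : N.Link → (N.Life → ℝ) → N.Life) (hpick : N.IsArgmaxRule pick)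
    (U₀ : N.VirtualQueues) (hU₀ : U₀.Nonneg) :
    -- under every parameter the decisions are integrable and all virtual queues are stable
    (∀ W : ℝ, 0 ≤ W →
      (∀ t e l, Integrable (fun ω => N.algFlow pick γ W U₀ (fun s => a s ω) t e l) μ) ∧
      DelayNet.MeanRateStable μ
        (fun t ω => (N.queues pick γ W U₀ (fun s => a s ω) t).sink) ∧
      ∀ i, i ≠ N.dest → ∀ l, DelayNet.MeanRateStable μ
        (fun t ω => (N.queues pick γ W U₀ (fun s => a s ω) t).node i l)) ∧
    -- the convergence time is finite and grows at most linearly in the parameter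
    (∀ ε : ℝ, 0 < ε → ∃ K : ℝ, ∀ W : ℝ, 1 ≤ W → ∃ τ : ℕ,
      N.convergenceTime (N.meanRate μ a) γ μ
        (fun t ω => N.algFlow pick γ W U₀ (fun s => a s ω) t) ε = (τ : ℕ∞) ∧
      (τ : ℝ) ≤ K * W) ∧
    -- constants for the drift bound exist, and each of them bounds the optimality gap
    (∃ B : ℝ, N.IsDriftConstant γ Amax B) ∧
    (∀ B : ℝ, N.IsDriftConstant γ Amax B → ∀ W : ℝ, 0 < W →
      limsup (fun T : ℕ => (∑ t ∈ Finset.range T,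
        ∫ ω, N.cost (N.algFlow pick γ W U₀ (fun s => a s ω) t) ∂μ) / (T : ℝ)) atTop
      ≤ N.optCost (N.meanRate μ a) γ + B / W) :=
  ⟨fun _ hW => ⟨fun t e l => ((ha.integrable_algFlow hpick t).eval e).eval l,
    ha.meanRateStable_queues hcap hpick hU₀ hW⟩,
  fun _ hε => ha.exists_convergenceTime_le hcap hpick hU₀ hε,
  N.exists_isDriftConstant γ Amax,
  fun _ hB _ hW => ha.limsup_cost_le hcap hpick hU₀ hB hW⟩
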